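/- A *tropical meromorphic* function is a continuous piecewise linear function $f:\mathbb R\to\mathbb R$ (arbitrary real slopes, finitely many break points in every bounded interval). Put $\omega_f(x)=\lim_{\varepsilon\to0+}\bigl(f'(x+\varepsilon)-f'(x-\varepsilon)\bigr)$; a point $b$ with $\omega_f(b)<0$ is a pole of $f$ of multiplicity $-\omega_f(b)$. Let $n(r,f)$ be the sum of the multiplicities of the poles of $f$ in $(-r,r)$, and $$m(r,f)=\tfrac12\bigl(f^+(r)+f^+(-r)\bigr),\qquad N(r,f)=\tfrac12\int_0^r n(t,f)\,dt,\qquad T(r,f)=m(r,f)+N(r,f),$$ where $f^+=\max(f,0)$. Let $$\rho_2(f)=\limsup_{r\to\infty}\frac{\log\log T(r,f)}{\log r},\qquad L_f=\inf\{f(b):\omega_f(b)<0\},$$ with $L_f=+\infty$ if $f$ has no poles. In tropical notation $f\oplus a=\max(f,a)$ and $1_\circ\oslash g=-g$. **Theorem (second main theorem).** Let $f$ be a nonconstant tropical meromorphic function of hyper-order $\rho_2=\rho_2(f)<1$, let $0<\delta<1-\rho_2$, let $q\ge1$, and let $a_1,\dots,a_q\in\mathbb R$ be distinct with $\max(a_1,\dots,a_q)<L_f$.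 Then there are a measurable set $E\subset(0,\infty)$ of finite logarithmic measure, $\int_E dr/r<\infty$, and a function $S:\mathbb R\to\mathbb R$ with $S(r)=o\bigl(T(r,f)/r^\delta\bigr)$ as $r\to\infty$ outside $E$, such that for all $r>0$ with $r\notin E$ $$(q-1)\,T(r,f)\le\sum_{j=1}^q N\bigl(r,1_\circ\oslash(f\oplus a_j)\bigr)-N\bigl(r,1_\circ\oslash f\bigr)+S(r).$$ -/

import Mathlib

open Filter Topology Asymptotics

namespace TropicalNevanlinna

/-- A tropical meromorphic function: a continuous piecewise linear function `f : ℝ → ℝ` with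
arbitrary real slopes. The break points lie in a set that meets every bounded interval in a finite
set, and `f` is affine on every open interval that contains no break point. -/
def IsMeromorphic (f : ℝ → ℝ) : Prop :=
  Continuous f ∧ ∃ S : Set ℝ, (∀ r : ℝ, (S ∩ Set.Icc (-r) r).Finite) ∧
    ∀ u v : ℝ, Disjoint (Set.Ioo u v) S →
      ∃ m b : ℝ, ∀ x ∈ Set.Ioo u v, f x = m * x + b

/-- The jump of the slope, `ω_f(x) = lim_{ε → 0+} (f'(x + ε) - f'(x - ε))`. The limit exists for
every tropical meromorphic `f`. -/
noncomputable def slopeJump (f : ℝ → ℝ) (x : ℝ) : ℝ :=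
  limUnder (𝓝[>] (0 : ℝ)) fun ε : ℝ => deriv f (x + ε) - deriv f (x - ε)

/-- The poles of `f`: the points with `ω_f(x) < 0`. The multiplicity of a pole is `-ω_f(x)`. -/
def poles (f : ℝ → ℝ) : Set ℝ := {x | slopeJump f x < 0}

/-- `n(r, f)`: the sum of the multiplicities of the poles of `f` in `(-r, r)`. -/
noncomputable def poleCount (r : ℝ) (f : ℝ → ℝ) : ℝ :=
  ∑ᶠ b ∈ poles f ∩ Set.Ioo (-r) r, -slopeJump f b

/-- The proximity function `m(r, f) = (f⁺(r) + f⁺(-r)) / 2`. -/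
noncomputable def proximity (r : ℝ) (f : ℝ → ℝ) : ℝ :=
  (max (f r) 0 + max (f (-r)) 0) / 2

/-- The counting function `N(r, f) = (1/2) ∫_0^r n(t, f) dt`. -/
noncomputable def counting (r : ℝ) (f : ℝ → ℝ) : ℝ :=
  1 / 2 * ∫ t in (0 : ℝ)..r, poleCount t f

/-- The characteristic function `T(r, f) = m(r, f) + N(r, f)`. -/
noncomputable def characteristic (r : ℝ) (f : ℝ → ℝ) : ℝ :=
  proximity r f + counting r f

/-- The hyper-order `ρ₂(f) = limsup_{r → ∞} log log T(r, f) / log r`, an extended real number. -/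
noncomputable def hyperOrder (f : ℝ → ℝ) : EReal :=
  limsup (fun r : ℝ =>
    ((Real.log (Real.log (characteristic r f)) / Real.log r : ℝ) : EReal)) atTop

/-- `L_f`: the infimum of `f(b)` over all poles `b` of `f`; it is `+∞` if `f` has no poles. -/
noncomputable def poleInf (f : ℝ → ℝ) : EReal :=
  sInf ((fun b : ℝ => (f b : EReal)) '' poles f)

/-- `E ⊆ (0, ∞)` is measurable and has finite logarithmic measure, `∫_E dr / r < ∞`. -/
def FiniteLogMeasure (E : Set ℝ) : Prop :=
  MeasurableSet E ∧ E ⊆ Set.Ioi 0 ∧ ∫⁻ r in E, ENNReal.ofReal (1 / r) < ⊤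

end TropicalNevanlinna

open TropicalNevanlinna

/-!
# A second main theorem for tropical meromorphic functions

The slope jumps of a piecewise linear `f` in `(-r, r)` add up to the difference of the slopes at the
two ends (`IsPiecewiseLinear.finsum_slopeJump`). Integrating this in `r` gives the tropical Jensen
formula `(f(r) + f(-r)) / 2 = f(0) + N(r, -f) - N(r, f)` (`IsPiecewiseLinear.jensen`).

If `a < L_f`, then `max f a` has the same poles as `f`, with the same multiplicities
(`IsPiecewiseLinear.counting_max`). Jensen's formula for `max f a` therefore says that
`N(r, -max f a)` is `T(r, f)` up to a bounded term, and Jensen's formula for `f` gives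
`N(r, -f) ≤ T(r, f) - f(0)`. Summing over the `a_j` yields the inequality for every `r > 0`, with a
constant error term `S` and an empty exceptional set.

It remains to see that a constant is `o(T(r, f) / r ^ δ)`. Each pole of `f` or of `-f` makes the
corresponding counting function grow linearly, and an `f` without jumps is affine, so `T(r, f)`
grows at least linearly (`IsPiecewiseLinear.exists_linear_le_characteristic`). In particular the
hyper-order is nonnegative, so `δ < 1` and `T(r, f) / r ^ δ` tends to infinity.
-/

namespace TropicalNevanlinna

/-! ### One-sided slopes -/

/-- `f` is affine with slope `l` just to the left of `x` and affine with slope `r` just to the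
right of `x`. -/
def HasSlopes (f : ℝ → ℝ) (x l r : ℝ) : Prop :=
  (∀ᶠ y in 𝓝[≤] x, f y = f x + l * (y - x)) ∧ ∀ᶠ y in 𝓝[≥] x, f y = f x + r * (y - x)

theorem hasSlopes_iff {f : ℝ → ℝ} {x l r : ℝ} :
    HasSlopes f x l r ↔ ∃ ε > 0, (∀ y ∈ Set.Ioc (x - ε) x, f y = f x + l * (y - x)) ∧
      ∀ y ∈ Set.Ico x (x + ε), f y = f x + r * (y - x) := by
  constructor
  · rintro ⟨h1, h2⟩
    obtain ⟨u, hu, hu'⟩ := mem_nhdsLE_iff_exists_Ioc_subset.1 h1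
    obtain ⟨v, hv, hv'⟩ := mem_nhdsGE_iff_exists_Ico_subset.1 h2
    simp only [Set.mem_Iio, Set.mem_Ioi] at hu hv
    refine ⟨min (x - u) (v - x), lt_min (by linarith) (by linarith), fun y hy => hu' ?_,
      fun y hy => hv' ?_⟩
    · have := min_le_left (x - u) (v - x)
      exact ⟨by linarith [hy.1], hy.2⟩
    · have := min_le_right (x - u) (v - x)
      exact ⟨hy.1, by linarith [hy.2]⟩
  · rintro ⟨ε, hε, h1, h2⟩
    exact ⟨mem_of_superset (Ioc_mem_nhdsLE (by linarith)) h1,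
      mem_of_superset (Ico_mem_nhdsGE (by linarith)) h2⟩

theorem HasSlopes.continuousAt {f : ℝ → ℝ} {x l r : ℝ} (h : HasSlopes f x l r) :
    ContinuousAt f x := by
  rw [continuousAt_iff_continuous_left_right]
  have key : ∀ m : ℝ, Continuous fun y => f x + m * (y - x) := fun m => by fun_prop
  exact ⟨((key l).continuousWithinAt).congr_of_eventuallyEq h.1 (by simp),
    ((key r).continuousWithinAt).congr_of_eventuallyEq h.2 (by simp)⟩

theorem HasSlopes.hasDerivAt {f : ℝ → ℝ} {x m : ℝ} (h : HasSlopes f x m m) :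
    HasDerivAt f m x := by
  have h' : f =ᶠ[𝓝 x] fun y => f x + m * (y - x) := by
    rw [← nhdsLE_sup_nhdsGE]
    exact eventually_sup.2 h
  refine HasDerivAt.congr_of_eventuallyEq ?_ h'
  simpa using (((hasDerivAt_id x).sub_const x).const_mul m).const_add (f x)

theorem hasSlopes_of_mem_Ioo {f : ℝ → ℝ} {u v y m c x : ℝ}
    (h : ∀ z ∈ Set.Ioo u v, f z = c + m * (z - x)) (hy : y ∈ Set.Ioo u v) :
    HasSlopes f y m m := by
  have h' : ∀ᶠ z in 𝓝 y, f z = f y + m * (z - y) := by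
    filter_upwards [Ioo_mem_nhds hy.1 hy.2] with z hz
    rw [h z hz, h y hy]
    ring
  exact ⟨h'.filter_mono nhdsWithin_le_nhds, h'.filter_mono nhdsWithin_le_nhds⟩

/-- Next to a point with given one-sided slopes there are no further breaks. -/
theorem HasSlopes.exists_nearby {f : ℝ → ℝ} {x l r : ℝ} (h : HasSlopes f x l r) :
    ∃ ε > 0, (∀ y ∈ Set.Ioo (x - ε) x, HasSlopes f y l l) ∧
      ∀ y ∈ Set.Ioo x (x + ε), HasSlopes f y r r := by
  obtain ⟨ε, hε, h1, h2⟩ := hasSlopes_iff.1 h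
  exact ⟨ε, hε,
    fun y hy => hasSlopes_of_mem_Ioo (fun z hz => h1 z (Set.Ioo_subset_Ioc_self hz)) hy,
    fun y hy => hasSlopes_of_mem_Ioo (fun z hz => h2 z (Set.Ioo_subset_Ico_self hz)) hy⟩

theorem HasSlopes.unique {f : ℝ → ℝ} {x l r l' r' : ℝ} (h : HasSlopes f x l r)
    (h' : HasSlopes f x l' r') : l = l' ∧ r = r' := by
  obtain ⟨ε, hε, h1, h2⟩ := h.exists_nearby
  obtain ⟨ε', hε', h1', h2'⟩ := h'.exists_nearby
  have hm : 0 < min ε ε' := lt_min hε hε'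
  have ha := min_le_left ε ε'
  have hb := min_le_right ε ε'
  constructor
  · exact (h1 (x - min ε ε' / 2) ⟨by linarith, by linarith⟩).hasDerivAt.unique
      (h1' (x - min ε ε' / 2) ⟨by linarith, by linarith⟩).hasDerivAt
  · exact (h2 (x + min ε ε' / 2) ⟨by linarith, by linarith⟩).hasDerivAt.unique
      (h2' (x + min ε ε' / 2) ⟨by linarith, by linarith⟩).hasDerivAt

theorem HasSlopes.slopeJump_eq {f : ℝ → ℝ} {x l r : ℝ} (h : HasSlopes f x l r) :
    slopeJump f x = r - l := by
  obtain ⟨ε, hε, h1, h2⟩ := h.exists_nearby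
  refine Tendsto.limUnder_eq (tendsto_const_nhds.congr' ?_)
  filter_upwards [Ioo_mem_nhdsGT hε] with t ht
  rw [(h1 (x - t) ⟨by linarith [ht.2], by linarith [ht.1]⟩).hasDerivAt.deriv,
    (h2 (x + t) ⟨by linarith [ht.1], by linarith [ht.2]⟩).hasDerivAt.deriv]

theorem HasSlopes.neg {f : ℝ → ℝ} {x l r : ℝ} (h : HasSlopes f x l r) :
    HasSlopes (fun y => -f y) x (-l) (-r) := by
  refine ⟨h.1.mono fun y hy => ?_, h.2.mono fun y hy => ?_⟩ <;> · beta_reduce; rw [hy]; ring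

theorem HasSlopes.congr {f g : ℝ → ℝ} {x l r : ℝ} (h : HasSlopes f x l r)
    (hg : ∀ᶠ y in 𝓝 x, g y = f y) : HasSlopes g x l r := by
  have hx := hg.self_of_nhds
  refine ⟨?_, ?_⟩
  · filter_upwards [h.1, hg.filter_mono nhdsWithin_le_nhds] with y h1 h2
    rw [h2, h1, hx]
  · filter_upwards [h.2, hg.filter_mono nhdsWithin_le_nhds] with y h1 h2
    rw [h2, h1, hx]

theorem hasSlopes_const (c x : ℝ) : HasSlopes (fun _ => c) x 0 0 :=
  ⟨Eventually.of_forall fun y => by ring, Eventually.of_forall fun y => by ring⟩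

theorem HasSlopes.max_of_gt {f : ℝ → ℝ} {x l r a : ℝ} (h : HasSlopes f x l r) (hx : a < f x) :
    HasSlopes (fun y => max (f y) a) x l r :=
  h.congr ((continuousAt_const.eventually_lt h.continuousAt hx).mono fun _ hy => max_eq_left hy.le)

theorem HasSlopes.max_of_lt {f : ℝ → ℝ} {x l r a : ℝ} (h : HasSlopes f x l r) (hx : f x < a) :
    HasSlopes (fun y => max (f y) a) x 0 0 :=
  (hasSlopes_const a x).congr
    ((h.continuousAt.eventually_lt continuousAt_const hx).mono fun _ hy => max_eq_right hy.le)

theorem HasSlopes.max_of_eq {f : ℝ → ℝ} {x l r a : ℝ} (h : HasSlopes f x l r) (hx : f x = a) :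
    HasSlopes (fun y => max (f y) a) x (min l 0) (max r 0) := by
  subst hx
  refine ⟨?_, ?_⟩
  · filter_upwards [h.1, self_mem_nhdsWithin] with y hy hyx
    have hyx' : y - x ≤ 0 := by simpa using hyx
    rw [hy, max_self]
    rcases le_total l 0 with h0 | h0
    · rw [min_eq_left h0, max_eq_left (by nlinarith)]
    · rw [min_eq_right h0, max_eq_right (by nlinarith)]
      ring
  · filter_upwards [h.2, self_mem_nhdsWithin] with y hy hyx
    have hyx' : 0 ≤ y - x := by simpa using hyx
    rw [hy, max_self]
    rcases le_total r 0 with h0 | h0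
    · rw [max_eq_right h0, max_eq_right (by nlinarith)]
      ring
    · rw [max_eq_left h0, max_eq_left (by nlinarith)]

/-! ### Piecewise linear functions and the sum of the slope jumps -/

/-- `f` has one-sided slopes in the strong sense of `HasSlopes` at every point. This local form of
piecewise linearity passes to `-f` and to `max f a`. -/
def IsPiecewiseLinear (f : ℝ → ℝ) : Prop := ∀ x, ∃ l r, HasSlopes f x l r

theorem IsPiecewiseLinear.neg {f : ℝ → ℝ} (h : IsPiecewiseLinear f) :
    IsPiecewiseLinear fun y => -f y := fun x =>
  let ⟨_, _, hx⟩ := h x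
  ⟨_, _, hx.neg⟩

theorem IsPiecewiseLinear.max_const {f : ℝ → ℝ} (h : IsPiecewiseLinear f) (a : ℝ) :
    IsPiecewiseLinear fun y => max (f y) a := fun x => by
  obtain ⟨l, r, hx⟩ := h x
  rcases lt_trichotomy (f x) a with h1 | h1 | h1
  exacts [⟨_, _, hx.max_of_lt h1⟩, ⟨_, _, hx.max_of_eq h1⟩, ⟨_, _, hx.max_of_gt h1⟩]

theorem IsPiecewiseLinear.continuous {f : ℝ → ℝ} (h : IsPiecewiseLinear f) : Continuous f :=
  continuous_iff_continuousAt.2 fun x => by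
    obtain ⟨l, r, hx⟩ := h x
    exact hx.continuousAt

theorem IsPiecewiseLinear.slopeJump_neg {f : ℝ → ℝ} (h : IsPiecewiseLinear f) (x : ℝ) :
    slopeJump (fun y => -f y) x = -slopeJump f x := by
  obtain ⟨l, r, hx⟩ := h x
  rw [hx.slopeJump_eq, hx.neg.slopeJump_eq]
  ring

theorem IsMeromorphic.isPiecewiseLinear {f : ℝ → ℝ} (hf : IsMeromorphic f) :
    IsPiecewiseLinear f := by
  obtain ⟨hc, S, hS, hlin⟩ := hf
  intro x
  have hfin := hS (|x| + 1)
  have hopen : ((S ∩ Set.Icc (-(|x| + 1)) (|x| + 1)) \ {x})ᶜ ∈ 𝓝 x :=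
    (hfin.subset Set.sdiff_subset).isClosed.isOpen_compl.mem_nhds fun h => h.2 rfl
  have hI : Set.Ioo (-(|x| + 1)) (|x| + 1) ∈ 𝓝 x :=
    Ioo_mem_nhds (by linarith [neg_abs_le x]) (by linarith [le_abs_self x])
  obtain ⟨ε, hε, hsub⟩ := Metric.mem_nhds_iff.1 (inter_mem hopen hI)
  rw [Real.ball_eq_Ioo] at hsub
  have hdis : ∀ y ∈ Set.Ioo (x - ε) (x + ε), y ≠ x → y ∉ S := fun y hy hyx hyS =>
    (hsub hy).1 ⟨⟨hyS, Set.Ioo_subset_Icc_self (hsub hy).2⟩, hyx⟩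
  -- An affine formula on an open interval extends by continuity to its end points.
  have key : ∀ u v : ℝ, u < v → Disjoint (Set.Ioo u v) S → x ∈ Set.Icc u v →
      ∃ m, ∀ y ∈ Set.Icc u v, f y = f x + m * (y - x) := by
    intro u v huv hd hx
    obtain ⟨m, b, hmb⟩ := hlin u v hd
    have hcl : Set.EqOn f (fun y => m * y + b) (Set.Icc u v) := by
      rw [← closure_Ioo huv.ne]
      exact Set.EqOn.closure hmb hc (by fun_prop)
    refine ⟨m, fun y hy => ?_⟩
    rw [hcl hy, hcl hx]
    ring
  obtain ⟨l, hl⟩ := key (x - ε) x (by linarith)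
    (Set.disjoint_left.2 fun y hy => hdis y ⟨hy.1, by linarith [hy.2]⟩ hy.2.ne)
    ⟨by linarith, le_rfl⟩
  obtain ⟨r, hr⟩ := key x (x + ε) (by linarith)
    (Set.disjoint_left.2 fun y hy => hdis y ⟨by linarith [hy.1], hy.2⟩ hy.1.ne')
    ⟨le_rfl, by linarith⟩
  exact ⟨l, r, hasSlopes_iff.2 ⟨ε, hε, fun y hy => hl y (Set.Ioc_subset_Icc_self hy),
    fun y hy => hr y (Set.Ico_subset_Icc_self hy)⟩⟩

theorem IsPiecewiseLinear.eventually_slopeJump_eq_zero {f : ℝ → ℝ} (h : IsPiecewiseLinear f)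
    (x : ℝ) : ∀ᶠ y in 𝓝[≠] x, slopeJump f y = 0 := by
  obtain ⟨l, r, hx⟩ := h x
  obtain ⟨ε, hε, h1, h2⟩ := hx.exists_nearby
  rw [← nhdsLT_sup_nhdsGT, eventually_sup]
  constructor
  · filter_upwards [Ioo_mem_nhdsLT (show x - ε < x by linarith)] with y hy
    rw [(h1 y hy).slopeJump_eq, sub_self]
  · filter_upwards [Ioo_mem_nhdsGT (show x < x + ε by linarith)] with y hy
    rw [(h2 y hy).slopeJump_eq, sub_self]

theorem IsPiecewiseLinear.finite_jumps {f : ℝ → ℝ} (h : IsPiecewiseLinear f) (u v : ℝ) :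
    (Set.Icc u v ∩ {x | slopeJump f x ≠ 0}).Finite := by
  by_contra hinf
  obtain ⟨x, -, hx⟩ := Set.Infinite.exists_accPt_of_subset_isCompact hinf isCompact_Icc
    Set.inter_subset_left
  -- An accumulation point of jumps contradicts the local form of `f` there.
  rw [accPt_iff_frequently_nhdsNE] at hx
  exact hx ((h.eventually_slopeJump_eq_zero x).mono fun y hy hy' => hy'.2 hy)

theorem IsPiecewiseLinear.countable_jumps {f : ℝ → ℝ} (h : IsPiecewiseLinear f) :
    {x | slopeJump f x ≠ 0}.Countable := by
  have : {x | slopeJump f x ≠ 0} =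
      ⋃ n : ℕ, Set.Icc (-(n : ℝ)) n ∩ {x | slopeJump f x ≠ 0} := by
    rw [← Set.iUnion_inter]
    refine (Set.inter_eq_right.2 fun x _ => ?_).symm
    obtain ⟨n, hn⟩ := exists_nat_ge |x|
    exact Set.mem_iUnion.2 ⟨n, abs_le.1 hn⟩
  rw [this]
  exact Set.countable_iUnion fun n => (h.finite_jumps _ _).countable

/-- The slope jumps in `(u, v)` add up to the change of slope from just right of `u` to just left
of `v`. -/
theorem IsPiecewiseLinear.finsum_slopeJump {f : ℝ → ℝ} {l r : ℝ → ℝ}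
    (h : ∀ x, HasSlopes f x (l x) (r x)) {u v : ℝ} (huv : u < v) :
    ∑ᶠ x ∈ Set.Ioo u v, slopeJump f x = l v - r u := by
  have hpl : IsPiecewiseLinear f := fun x => ⟨_, _, h x⟩
  have hj : ∀ x, slopeJump f x = r x - l x := fun x => (h x).slopeJump_eq
  have hzero : ∀ {s t : ℝ} {m : ℝ}, (∀ y ∈ Set.Ioo s t, HasSlopes f y m m) →
      ∑ᶠ x ∈ Set.Ioo s t, slopeJump f x = 0 := fun hm =>
    finsum_mem_of_eqOn_zero fun y hy => by
      simp [(hm y hy).slopeJump_eq]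
  have hfin : ∀ s t : ℝ, (Set.Ioo s t ∩ Function.support (slopeJump f)).Finite := fun s t =>
    (hpl.finite_jumps s t).subset fun y hy => ⟨Set.Ioo_subset_Icc_self hy.1, hy.2⟩
  have hsplit : ∀ {s t w : ℝ}, s < t → t < w → ∑ᶠ x ∈ Set.Ioo s w, slopeJump f x =
      ∑ᶠ x ∈ Set.Ioo s t, slopeJump f x + slopeJump f t +
        ∑ᶠ x ∈ Set.Ioo t w, slopeJump f x := by
    intro s t w hst htw
    rw [← Set.Ioo_union_Ico_eq_Ioo hst htw.le, ← Set.Ioo_insert_left htw,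
      finsum_mem_union' _ (hfin _ _), finsum_mem_insert' _ (by simp) (hfin _ _), add_assoc]
    · exact (hfin t w |>.insert t).subset fun y hy => by
        rcases hy with ⟨rfl | hy, hy'⟩
        exacts [Or.inl rfl, Or.inr ⟨hy, hy'⟩]
    · rw [Set.Ioo_insert_left htw]
      exact Set.disjoint_left.2 fun y hy hy' => absurd hy'.1 (not_le.2 hy.2)
  -- The difference of the two sides is a locally constant function of `v` on `(u, ∞)`.
  set G : ℝ → ℝ := fun v => ∑ᶠ x ∈ Set.Ioo u v, slopeJump f x - l v with hG
  have hloc : ∀ t ∈ Set.Ioi u, ∀ᶠ w in 𝓝[Set.Ioi u] t, G w = G t := by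
    intro t ht
    obtain ⟨ε, hε, h1, h2⟩ := (h t).exists_nearby
    have hn : Set.Ioo (max u (t - ε)) (t + ε) ∈ 𝓝 t :=
      Ioo_mem_nhds (max_lt ht (by linarith)) (by linarith)
    filter_upwards [mem_nhdsWithin_of_mem_nhds hn] with w hw
    have hw1 : u < w := (le_max_left _ _).trans_lt hw.1
    have hw2 : t - ε < w := (le_max_right _ _).trans_lt hw.1
    simp only [hG]
    rcases lt_trichotomy w t with hwt | rfl | hwt
    · have e1 := (h w).unique (h1 w ⟨hw2, hwt⟩)
      rw [hsplit hw1 hwt, hzero fun y hy => h1 y ⟨hw2.trans hy.1, hy.2⟩, hj, e1.1, e1.2]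
      ring
    · rfl
    · have e1 := (h w).unique (h2 w ⟨hwt, hw.2⟩)
      rw [hsplit ht hwt, hzero fun y hy => h2 y ⟨hy.1, hy.2.trans hw.2⟩, hj, e1.1]
      ring
  obtain ⟨ε, hε, h1, h2⟩ := (h u).exists_nearby
  have hw : u + ε / 2 ∈ Set.Ioo u (u + ε) := ⟨by linarith, by linarith⟩
  have hconst : G v = G (u + ε / 2) := by
    have hderiv : ∀ t : ℝ, u < t → HasDerivWithinAt G 0 (Set.Ioi u) t := fun t ht =>
      (hasDerivWithinAt_const t _ (G t)).congr_of_eventuallyEq (hloc t ht) rfl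
    have hle := (convex_Ioi u).norm_image_sub_le_of_norm_hasDerivWithin_le (C := 0)
      (fun t ht => hderiv t ht) (fun t _ => by simp) hw.1 huv
    rw [zero_mul, norm_le_zero_iff, sub_eq_zero] at hle
    exact hle
  have e1 := (h (u + ε / 2)).unique (h2 _ hw)
  simp only [hG] at hconst
  rw [hzero (fun y hy => h2 y ⟨hy.1, hy.2.trans hw.2⟩), e1.1] at hconst
  linarith

/-! ### The counting function and Jensen's formula -/

theorem poleCount_eq_finsum (f : ℝ → ℝ) (t : ℝ) :
    poleCount t f = ∑ᶠ x ∈ Set.Ioo (-t) t, max (-slopeJump f x) 0 := by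
  unfold poleCount
  classical
  refine finsum_congr fun x => ?_
  by_cases hx : x ∈ Set.Ioo (-t) t
  · by_cases hp : slopeJump f x < 0
    · have hx' : x ∈ poles f ∩ Set.Ioo (-t) t := ⟨hp, hx⟩
      rw [finsum_eq_if, finsum_eq_if, if_pos hx, if_pos hx', max_eq_left (by linarith)]
    · have hx' : x ∉ poles f ∩ Set.Ioo (-t) t := fun h => hp h.1
      rw [finsum_eq_if, finsum_eq_if, if_pos hx, if_neg hx', max_eq_right (by linarith)]
  · have hx' : x ∉ poles f ∩ Set.Ioo (-t) t := fun h => hx h.2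
    rw [finsum_eq_if, finsum_eq_if, if_neg hx, if_neg hx']

theorem IsPiecewiseLinear.finite_support_max {f : ℝ → ℝ} (h : IsPiecewiseLinear f) (t : ℝ) :
    (Set.Ioo (-t) t ∩ Function.support fun x => max (-slopeJump f x) 0).Finite :=
  (h.finite_jumps (-t) t).subset fun y hy => ⟨Set.Ioo_subset_Icc_self hy.1, fun h0 =>
    hy.2 (by simp [h0])⟩

theorem IsPiecewiseLinear.finsum_le_poleCount {f : ℝ → ℝ} (h : IsPiecewiseLinear f)
    {s : Set ℝ} {t : ℝ} (hs : s ⊆ Set.Ioo (-t) t) : ∑ᶠ x ∈ s, max (-slopeJump f x) 0 ≤ poleCount t f := by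
  rw [poleCount_eq_finsum, ← finsum_mem_add_sdiff' hs (h.finite_support_max t)]
  exact le_add_of_nonneg_right
    (finsum_nonneg fun x => finsum_nonneg fun _ => le_max_right _ _)

theorem IsPiecewiseLinear.poleCount_mono {f : ℝ → ℝ} (h : IsPiecewiseLinear f) :
    Monotone fun t => poleCount t f := by
  intro s t hst
  beta_reduce
  rw [poleCount_eq_finsum f s]
  exact h.finsum_le_poleCount (Set.Ioo_subset_Ioo (by linarith) hst)

theorem poleCount_nonneg (f : ℝ → ℝ) (t : ℝ) : 0 ≤ poleCount t f := by
  rw [poleCount_eq_finsum]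
  exact finsum_nonneg fun x => finsum_nonneg fun _ => le_max_right _ _

theorem IsPiecewiseLinear.intervalIntegrable_poleCount {f : ℝ → ℝ} (h : IsPiecewiseLinear f)
    (a b : ℝ) : IntervalIntegrable (fun t => poleCount t f) MeasureTheory.volume a b :=
  h.poleCount_mono.intervalIntegrable

theorem counting_nonneg (f : ℝ → ℝ) {r : ℝ} (hr : 0 ≤ r) : 0 ≤ counting r f :=
  mul_nonneg (by norm_num) (intervalIntegral.integral_nonneg hr fun t _ => poleCount_nonneg f t)

theorem IsPiecewiseLinear.poleCount_neg_sub {f : ℝ → ℝ} (h : IsPiecewiseLinear f) (t : ℝ) :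
    poleCount t (fun y => -f y) - poleCount t f = ∑ᶠ x ∈ Set.Ioo (-t) t, slopeJump f x := by
  rw [poleCount_eq_finsum, poleCount_eq_finsum, sub_eq_iff_eq_add, ← finsum_mem_add_distrib'
    ((h.finite_jumps (-t) t).subset fun y hy => ⟨Set.Ioo_subset_Icc_self hy.1, hy.2⟩)
    (h.finite_support_max t)]
  refine finsum_mem_congr rfl fun x _ => ?_
  rw [h.slopeJump_neg, neg_neg, ← sub_eq_iff_eq_add]
  exact max_zero_sub_max_neg_zero_eq_self _

/-- The tropical Jensen formula. -/
theorem IsPiecewiseLinear.jensen {f : ℝ → ℝ} (h : IsPiecewiseLinear f) {r : ℝ} (hr : 0 ≤ r) :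
    (f r + f (-r)) / 2 = f 0 + counting r (fun y => -f y) - counting r f := by
  choose l r' hs using h
  have h : IsPiecewiseLinear f := fun x => ⟨_, _, hs x⟩
  -- Off the countable set of `t` with a break at `t` or `-t`, the derivative of `f t + f (-t)` is
  -- the total jump in `(-t, t)`.
  have hint := (h.neg.intervalIntegrable_poleCount 0 r).sub (h.intervalIntegrable_poleCount 0 r)
  have hcount : ({x | slopeJump f x ≠ 0} ∪ Neg.neg ⁻¹' {x | slopeJump f x ≠ 0}).Countable :=
    h.countable_jumps.union (h.countable_jumps.preimage neg_injective)
  have hsmooth : ∀ x, slopeJump f x = 0 → HasDerivAt f (l x) x ∧ l x = r' x := fun x hx => by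
    have e : r' x = l x := by linarith [(hs x).slopeJump_eq]
    have := hs x
    rw [e] at this
    exact ⟨this.hasDerivAt, e.symm⟩
  have hftc := MeasureTheory.integral_eq_of_hasDerivAt_off_countable_of_le
    (fun t => f t + f (-t))
    (fun t => poleCount t (fun y => -f y) - poleCount t f) hr hcount
    (h.continuous.add (h.continuous.comp continuous_neg)).continuousOn (fun t ht => by
      have hn : slopeJump f t = 0 ∧ slopeJump f (-t) = 0 := by
        simpa [not_or] using ht.2
      obtain ⟨d1, -⟩ := hsmooth t hn.1
      obtain ⟨d2, e2⟩ := hsmooth (-t) hn.2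
      rw [h.poleCount_neg_sub, IsPiecewiseLinear.finsum_slopeJump hs (by linarith [ht.1.1]), ← e2]
      have := d1.add (d2.scomp t (hasDerivAt_neg t))
      simpa [sub_eq_add_neg, Function.comp_def, Pi.add_def] using this) hint
  rw [intervalIntegral.integral_sub (h.neg.intervalIntegrable_poleCount 0 r)
    (h.intervalIntegrable_poleCount 0 r)] at hftc
  simp only [neg_zero] at hftc
  unfold counting
  linarith

/-! ### Truncation below the poles -/

theorem gt_of_lt_poleInf {f : ℝ → ℝ} {a x : ℝ} (ha : (a : EReal) < poleInf f)
    (hx : slopeJump f x < 0) : a < f x := by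
  have : poleInf f ≤ (f x : EReal) := sInf_le ⟨x, hx, rfl⟩
  exact_mod_cast ha.trans_le this

/-- Below `L_f` truncation changes no pole: `f` exceeds `a` at its poles, and where `f` crosses
`a` it is convex, so that `max f a` is convex there, too. -/
theorem IsPiecewiseLinear.counting_max {f : ℝ → ℝ} (h : IsPiecewiseLinear f) {a : ℝ}
    (ha : (a : EReal) < poleInf f) (r : ℝ) :
    counting r (fun y => max (f y) a) = counting r f := by
  have hpt : ∀ x, max (-slopeJump (fun y => max (f y) a) x) 0 = max (-slopeJump f x) 0 := by
    intro x
    obtain ⟨l, r, hx⟩ := h x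
    have hpole := gt_of_lt_poleInf ha (x := x)
    rw [hx.slopeJump_eq] at hpole ⊢
    rcases lt_trichotomy (f x) a with h1 | h1 | h1
    · have : 0 ≤ r - l := not_lt.1 fun hlt => h1.not_gt (hpole hlt)
      rw [(hx.max_of_lt h1).slopeJump_eq, max_eq_right (by linarith), max_eq_right (by linarith)]
    · have : 0 ≤ r - l := not_lt.1 fun hlt => h1.not_gt (hpole hlt)
      have h2 := min_le_right l 0
      have h3 := le_max_right r 0
      rw [(hx.max_of_eq h1).slopeJump_eq, max_eq_right (by linarith), max_eq_right (by linarith)]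
    · rw [(hx.max_of_gt h1).slopeJump_eq]
  simp only [counting, poleCount_eq_finsum, hpt]

/-! ### Linear growth of the characteristic function -/

theorem proximity_nonneg (f : ℝ → ℝ) (r : ℝ) : 0 ≤ proximity r f :=
  div_nonneg (add_nonneg (le_max_right _ _) (le_max_right _ _)) (by norm_num)

/-- The first main theorem for the reciprocal. -/
theorem IsPiecewiseLinear.characteristic_eq {f : ℝ → ℝ} (h : IsPiecewiseLinear f) {r : ℝ}
    (hr : 0 ≤ r) : characteristic r f = characteristic r (fun y => -f y) + f 0 := by
  have hj := h.jensen hr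
  have h1 := max_zero_sub_max_neg_zero_eq_self (f r)
  have h2 := max_zero_sub_max_neg_zero_eq_self (f (-r))
  unfold characteristic proximity
  linarith

/-- A pole of multiplicity `μ` at `b` contributes `μ (r - |b|) / 2` to `N(r, f)`. -/
theorem IsPiecewiseLinear.le_counting {f : ℝ → ℝ} (h : IsPiecewiseLinear f) {b r : ℝ}
    (hr : |b| ≤ r) :
    -slopeJump f b / 2 * (r - |b|) ≤ counting r f := by
  have hlow : ∀ t ∈ Set.Ioo |b| r, -slopeJump f b ≤ poleCount t f := by
    intro t ht
    have hbt : b ∈ Set.Ioo (-t) t := abs_lt.1 ht.1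
    have := h.finsum_le_poleCount (Set.singleton_subset_iff.2 hbt)
    rw [finsum_mem_singleton] at this
    exact (le_max_left _ _).trans this
  have h1 : ∫ t in |b|..r, -slopeJump f b ≤ ∫ t in |b|..r, poleCount t f :=
    intervalIntegral.integral_mono_on_of_le_Ioo hr (by simp)
      (h.intervalIntegrable_poleCount _ _) hlow
  have h2 : 0 ≤ ∫ t in (0 : ℝ)..|b|, poleCount t f :=
    intervalIntegral.integral_nonneg (abs_nonneg b) fun t _ => poleCount_nonneg f t
  have h3 := intervalIntegral.integral_add_adjacent_intervals
    (h.intervalIntegrable_poleCount 0 |b|) (h.intervalIntegrable_poleCount |b| r)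
  rw [intervalIntegral.integral_const, smul_eq_mul] at h1
  unfold counting
  rw [← h3]
  linarith

theorem IsPiecewiseLinear.exists_affine {f : ℝ → ℝ} (h : IsPiecewiseLinear f)
    (h0 : ∀ x, slopeJump f x = 0) : ∃ m, ∀ x, f x = m * x + f 0 := by
  choose l r hs using h
  have hlr : ∀ x, l x = r x := fun x => by
    have := (hs x).slopeJump_eq
    rw [h0 x] at this
    linarith
  have hmono : ∀ u v, u < v → r u = l v := fun u v huv => by
    have := IsPiecewiseLinear.finsum_slopeJump hs huv
    simp only [h0, finsum_zero] at this
    linarith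
  have hl : ∀ x, l x = l 0 := fun x => by
    rcases lt_trichotomy x 0 with hx | rfl | hx
    · rw [hlr, hmono x 0 hx]
    · rfl
    · rw [← hmono 0 x hx, hlr]
  have hd : ∀ x, HasDerivAt (fun y => f y - l 0 * y) 0 x := fun x => by
    have h1 := hs x
    rw [← hlr x, hl x] at h1
    simpa [Pi.sub_def] using h1.hasDerivAt.sub ((hasDerivAt_id x).const_mul (l 0))
  refine ⟨l 0, fun x => ?_⟩
  have := is_const_of_deriv_eq_zero (fun x => (hd x).differentiableAt) (fun x => (hd x).deriv) x 0
  simp only [mul_zero, sub_zero] at this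
  linarith

/-- The characteristic of a nonconstant function grows at least linearly. -/
theorem IsPiecewiseLinear.exists_linear_le_characteristic {f : ℝ → ℝ} (h : IsPiecewiseLinear f)
    (hnc : ¬ ∃ k : ℝ, ∀ x, f x = k) :
    ∃ c > 0, ∃ C, ∀ᶠ r in atTop, c * r - C ≤ characteristic r f := by
  by_cases h0 : ∀ x, slopeJump f x = 0
  · obtain ⟨m, hm⟩ := h.exists_affine h0
    have hm0 : m ≠ 0 := fun h => hnc ⟨f 0, fun x => by simpa [h] using hm x⟩
    refine ⟨|m| / 2, by positivity, |f 0|, ?_⟩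
    filter_upwards [eventually_ge_atTop 0] with r hr
    have hN := counting_nonneg f hr
    have hp : |m| * r - |f 0| ≤ max (f r) 0 + max (f (-r)) 0 := by
      have h1 := neg_abs_le (f 0)
      have h2 := hm r
      have h3 := hm (-r)
      have e1 := le_max_left (f r) 0
      have e2 := le_max_left (f (-r)) 0
      have e3 := le_max_right (f r) 0
      have e4 := le_max_right (f (-r)) 0
      rcases abs_cases m with ⟨hm', _⟩ | ⟨hm', _⟩ <;> rw [hm'] <;> linarith
    unfold characteristic proximity
    linarith [abs_nonneg (f 0)]
  · push Not at h0
    obtain ⟨b, hb⟩ := h0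
    rcases hb.lt_or_gt with hb | hb
    · refine ⟨-slopeJump f b / 2, by linarith, -slopeJump f b / 2 * |b|, ?_⟩
      filter_upwards [eventually_ge_atTop |b|] with r hr
      have := h.le_counting hr
      have := proximity_nonneg f r
      unfold characteristic
      linarith
    -- Here `b` is a pole of `-f`, and `T(r, f) = T(r, -f) + f 0`.
    · refine ⟨slopeJump f b / 2, by linarith, slopeJump f b / 2 * |b| - f 0, ?_⟩
      filter_upwards [eventually_ge_atTop |b|] with r hr
      have h1 := h.neg.le_counting hr
      rw [h.slopeJump_neg, neg_neg] at h1
      have h2 := proximity_nonneg (fun y => -f y) r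
      rw [h.characteristic_eq ((abs_nonneg b).trans hr)]
      unfold characteristic
      linarith

theorem tendsto_linear_div_rpow_atTop {c : ℝ} (hc : 0 < c) (C : ℝ) {δ : ℝ} (hδ0 : 0 < δ)
    (hδ : δ < 1) : Tendsto (fun r : ℝ => (c * r - C) / r ^ δ) atTop atTop := by
  have h1 : Tendsto (fun r : ℝ => c * r ^ (1 - δ)) atTop atTop :=
    (tendsto_rpow_atTop (by linarith)).const_mul_atTop hc
  have h2 : Tendsto (fun r : ℝ => -C * r ^ (-δ)) atTop (𝓝 (-C * 0)) :=
    (tendsto_rpow_neg_atTop hδ0).const_mul _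
  refine (h1.atTop_add h2).congr' ?_
  filter_upwards [eventually_gt_atTop 0] with r hr
  rw [Real.rpow_sub hr, Real.rpow_one, Real.rpow_neg hr.le]
  ring

theorem hyperOrder_nonneg {f : ℝ → ℝ} {c C : ℝ} (hc : 0 < c)
    (hT : ∀ᶠ r in atTop, c * r - C ≤ characteristic r f) : 0 ≤ hyperOrder f := by
  refine le_limsup_of_frequently_le (Eventually.frequently ?_)
  have hlin : Tendsto (fun r : ℝ => c * r - C) atTop atTop :=
    tendsto_atTop_add_const_right _ _ (tendsto_id.const_mul_atTop hc)
  filter_upwards [hT, hlin.eventually_ge_atTop (Real.exp 1), eventually_ge_atTop 1]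
    with r h1 h2 h3
  have h4 : 1 ≤ Real.log (characteristic r f) :=
    (Real.le_log_iff_exp_le ((Real.exp_pos 1).trans_le (h2.trans h1))).2 (h2.trans h1)
  exact_mod_cast div_nonneg (Real.log_nonneg h4) (Real.log_nonneg h3)

/-- With `a < L_f`, the zeros of `f ⊕ a` are counted by `T(r, f)` up to a bounded term. -/
theorem IsPiecewiseLinear.characteristic_le_counting_neg_max {f : ℝ → ℝ}
    (h : IsPiecewiseLinear f) {a : ℝ} (ha : (a : EReal) < poleInf f) {r : ℝ} (hr : 0 ≤ r) :
    characteristic r f ≤ counting r (fun y => -max (f y) a) + (max (f 0) a + |a|) := by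
  have hj := (h.max_const a).jensen hr
  rw [h.counting_max ha] at hj
  have key : ∀ y, max y 0 ≤ max y a + |a| := fun y =>
    max_le (by linarith [le_max_left y a, abs_nonneg a])
      (by linarith [le_max_right y a, neg_abs_le a])
  have h1 := key (f r)
  have h2 := key (f (-r))
  unfold characteristic proximity
  linarith

theorem IsPiecewiseLinear.counting_neg_le_characteristic {f : ℝ → ℝ}
    (h : IsPiecewiseLinear f) {r : ℝ} (hr : 0 ≤ r) :
    counting r (fun y => -f y) ≤ characteristic r f - f 0 := by
  have := h.characteristic_eq hr
  have := proximity_nonneg (fun y => -f y) r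
  unfold characteristic at *
  linarith

end TropicalNevanlinna

open TropicalNevanlinna
theorem theorem5p2 (f : ℝ → ℝ) (hf : IsMeromorphic f) (hnc : ¬ ∃ k : ℝ, ∀ x, f x = k)
    (hρ : hyperOrder f < 1)
    (δ : ℝ) (hδ0 : 0 < δ) (hδ : (δ : EReal) < 1 - hyperOrder f)
    (q : ℕ) (hq : 1 ≤ q) (a : Fin q → ℝ) (ha : Function.Injective a)
    (haL : ∀ j, (a j : EReal) < poleInf f) :
    ∃ E : Set ℝ, FiniteLogMeasure E ∧
      ∃ S : ℝ → ℝ,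
        S =o[atTop ⊓ 𝓟 Eᶜ] (fun r : ℝ => characteristic r f / r ^ δ) ∧
        ∀ r : ℝ, 0 < r → r ∉ E →
          ((q : ℝ) - 1) * characteristic r f ≤
            ∑ j, counting r (fun x => -max (f x) (a j)) - counting r (fun x => -f x) + S r := by
  have h := hf.isPiecewiseLinear
  obtain ⟨c, hc, C, hT⟩ := h.exists_linear_le_characteristic hnc
  have hδ1 : δ < 1 := by
    have h1 : 1 - hyperOrder f ≤ 1 - 0 := EReal.sub_le_sub le_rfl (hyperOrder_nonneg hc hT)
    rw [sub_zero] at h1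
    exact_mod_cast hδ.trans_le h1
  refine ⟨∅, ⟨MeasurableSet.empty, Set.empty_subset _, by simp⟩,
    fun _ => ∑ j, (max (f 0) (a j) + |a j|) - f 0, ?_, fun r hr _ => ?_⟩
  · refine IsLittleO.mono ?_ inf_le_left
    refine isLittleO_const_left.2 (Or.inr (tendsto_norm_atTop_atTop.comp ?_))
    refine tendsto_atTop_mono' _ ?_ (tendsto_linear_div_rpow_atTop hc C hδ0 hδ1)
    filter_upwards [hT, eventually_gt_atTop 0] with r h1 hr
    gcongr
  · have h1 := Finset.sum_le_sum fun j (_ : j ∈ Finset.univ) =>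
      h.characteristic_le_counting_neg_max (haL j) hr.le
    rw [Finset.sum_add_distrib, Finset.sum_const, Finset.card_univ, Fintype.card_fin,
      nsmul_eq_mul] at h1
    have h2 := h.counting_neg_le_characteristic hr.le
    linarith
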